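/- A \emph{tree order} is a partial order $X$ with a minimum element (its root) such that $\{y \in X \mid y \le x\}$ is linearly ordered for every $x \in X$. A \emph{branchwise-real tree} is a tree order $X$ in which every branch (that is, every maximal chain) is order-isomorphic to a real interval, and in which for all $x, y \in X$ the set $\{z \in X \mid z \le x \text{ and } z \le y\}$ has a maximum element. The \emph{degree} of $x \in X$ is the number of equivalence classes of $\{y \in X \mid y > x\}$ under the relation: $y \sim_x z$ if and only if there is $w > x$ with $w \le y$ and $w \le z$. The tree $X$ is \emph{uniformly $\kappa$-branching} if every element of $X$ has degree $\kappa$; it is \emph{rigid} if its only order-automorphism is the identity; and it is \emph{continuously gradable} if there is a strictly increasing function $\ell \colon X \to \mathbb{R}$ such that for all $x < y$ in $X$ the restriction of $\ell$ to $[x,y] = \{z \in X \mid x \le z \le y\}$ is an order-isomorphism onto the real interval $[\ell(x), \ell(y)]$. \textbf{Theorem.} Let $\kappa$ be a cardinal with $2 \le \kappa \le \mathfrak{c}^+$, where $\mathfrak{c}^+$ is the successor cardinal of the cardinality $\mathfrak{c}$ of the continuum. Then there is a branchwise-real tree which is uniformly $\kappa$-branching, rigid, and continuously gradable. -/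

import Mathlib

universe u

namespace BranchwiseReal

/-- A tree order: a partial order with a minimum element (the root) in which the set of
elements below any given element is linearly ordered. -/
class IsTreeOrder (X : Type u) [PartialOrder X] : Prop where
  isChain_Iic : ∀ x : X, IsChain (· ≤ ·) (Set.Iic x)
  exists_root : ∃ r : X, ∀ x : X, r ≤ x

/-- A branch of a partial order is a maximal chain. -/
def IsBranch {X : Type u} [PartialOrder X] (B : Set X) : Prop :=
  IsMaxChain (· ≤ ·) B

/-- A branchwise-real tree: a tree order in which every branch is order-isomorphic to a real
interval (that is, an order-convex set of reals) and any two elements have a meet. -/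
class IsBranchwiseRealTree (X : Type u) [PartialOrder X] : Prop extends IsTreeOrder X where
  branch_iso_interval : ∀ B : Set X, IsBranch B →
    ∃ I : Set ℝ, I.OrdConnected ∧ Nonempty (B ≃o I)
  exists_meet : ∀ x y : X, ∃ m : X, IsGreatest {z : X | z ≤ x ∧ z ≤ y} m

/-- The equivalence relation on the elements strictly above `x` whose classes are the connected
components above `x`: `y` and `z` are related when some `w > x` lies below both. -/
def componentSetoid {X : Type u} [PartialOrder X] [IsTreeOrder X] (x : X) :
    Setoid (Set.Ioi x) where
  r y z := ∃ w : X, x < w ∧ w ≤ (y : X) ∧ w ≤ (z : X)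
  iseqv :=
    { refl := fun y => ⟨y, y.2, le_refl _, le_refl _⟩
      symm := fun ⟨w, hw, hy, hz⟩ => ⟨w, hw, hz, hy⟩
      trans := by
        rintro y z v ⟨w, hw, hwy, hwz⟩ ⟨w', hw', hwz', hwv'⟩
        rcases (IsTreeOrder.isChain_Iic (z : X)).total hwz hwz' with h | h
        · exact ⟨w, hw, hwy, h.trans hwv'⟩
        · exact ⟨w', hw', h.trans hwy, hwv'⟩ }

/-- The degree of `x`: the number of connected components above `x`. -/
noncomputable def degree {X : Type u} [PartialOrder X] [IsTreeOrder X] (x : X) : Cardinal.{u} :=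
  Cardinal.mk (Quotient (componentSetoid x))

/-- A tree order is uniformly `κ`-branching if every element has degree `κ`. -/
def UniformlyBranching (X : Type u) [PartialOrder X] [IsTreeOrder X] (κ : Cardinal.{u}) : Prop :=
  ∀ x : X, degree x = κ

/-- A partial order is rigid if its only order-automorphism is the identity. -/
def Rigid (X : Type u) [PartialOrder X] : Prop :=
  ∀ f : X ≃o X, f = OrderIso.refl X

/-- A continuous grading: a strictly increasing `ℓ : X → ℝ` which, for all `x < y`, restricts to
an order-isomorphism from `[x, y]` onto the real interval `[ℓ x, ℓ y]`. -/
def IsContinuousGrading {X : Type u} [PartialOrder X] (ℓ : X → ℝ) : Prop :=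
  StrictMono ℓ ∧
    ∀ x y : X, x < y →
      ∃ e : Set.Icc x y ≃o Set.Icc (ℓ x) (ℓ y), ∀ z : Set.Icc x y, (e z : ℝ) = ℓ z

/-- A partial order is continuously gradable if it admits a continuous grading. -/
def ContinuouslyGradable (X : Type u) [PartialOrder X] : Prop :=
  ∃ ℓ : X → ℝ, IsContinuousGrading ℓ

end BranchwiseReal

/-! Paths `[0, t) → K` that are locally constant to the right, ordered by restriction, form a tree
graded by `time`; the label at `x.time` names the component above `x`, so every degree is `#K`. All
this survives in `Hereditary A` as long as `A` contains the `LeftConst` paths, so membership of the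
other paths is free to be used against automorphisms.

A nontrivial automorphism `f` moves some `z` to an incomparable element. Above `z` run continuum
many zigzag paths, one for each binary sequence, whose proper restrictions lie in the tree whatever
the choice of `A`. As `f` preserves suprema, a zigzag lies in the tree iff the images of its stages
have a supremum in `A`. The set `A` is built to violate this for one zigzag of each `Task`, a
countable record of what `f` does to the stages (`Task.exists_separating_set`, `Hereditary.rigid`).

For `#K = 𝔠⁺` there may be more than `𝔠` tasks, each with only `𝔠` zigzags. Hence labels are ranked
by ordinals (`exists_rank`), and tags woven into a zigzag make the ranks of its labels cofinal in
the rank of its task. So it cannot occur in a task of smaller rank; as at most `𝔠` tasks share a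
rank, each choice has fewer than `𝔠` earlier ones to avoid. -/

namespace BranchwiseReal

/-! ### Paths and their restriction order -/

/-- `σ` is constant on some interval `[s, v)` with `v > s`. -/
def RightConstAt {K : Type u} (σ : ℝ → K) (s : ℝ) : Prop :=
  ∃ v > s, ∀ u ∈ Set.Ico s v, σ u = σ s

theorem rightConstAt_const {K : Type u} (k : K) (s : ℝ) : RightConstAt (fun _ => k) s :=
  ⟨s + 1, by linarith, fun _ _ => rfl⟩

theorem RightConstAt.glue {K : Type u} {σ τ : ℝ → K} {r : ℝ}
    (hσ : ∀ s < r, RightConstAt σ s) (hτ : ∀ s, r ≤ s → RightConstAt τ s) (s : ℝ) :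
    RightConstAt (fun s => if s < r then σ s else τ s) s := by
  rcases lt_or_ge s r with h | h
  · obtain ⟨v, hv, H⟩ := hσ s h
    refine ⟨min v r, lt_min hv h, fun u hu => ?_⟩
    have h1 := hu.2.trans_le (min_le_left _ _)
    have h2 := hu.2.trans_le (min_le_right _ _)
    simp only [h, h2, if_true]
    exact H u ⟨hu.1, h1⟩
  · obtain ⟨v, hv, H⟩ := hτ s h
    refine ⟨v, hv, fun u hu => ?_⟩
    simp only [not_lt.2 h, not_lt.2 (h.trans hu.1), if_false]
    exact H u hu

/-- A path `[0, time) → K` that is locally constant to the right, extended by `k₀` outside its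
domain. The paths with labels in `K` are the points of a tree whose order is restriction. -/
@[ext]
structure RealPath {K : Type u} (k₀ : K) where
  time : ℝ
  label : ℝ → K
  time_nonneg : 0 ≤ time
  label_of_neg : ∀ s < 0, label s = k₀
  label_of_time_le : ∀ s, time ≤ s → label s = k₀
  rightConstAt : ∀ s, RightConstAt label s

namespace RealPath

variable {K : Type u} {k₀ : K}

instance : PartialOrder (RealPath k₀) where
  le x y := x.time ≤ y.time ∧ ∀ s < x.time, x.label s = y.label s
  le_refl x := ⟨le_rfl, fun _ _ => rfl⟩
  le_trans x y z hxy hyz :=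
    ⟨hxy.1.trans hyz.1, fun s hs => (hxy.2 s hs).trans (hyz.2 s (hs.trans_le hxy.1))⟩
  le_antisymm x y hxy hyx := by
    have ht := le_antisymm hxy.1 hyx.1
    refine RealPath.ext ht (funext fun s => ?_)
    rcases lt_or_ge s x.time with h | h
    · exact hxy.2 s h
    -- The default `k₀` outside the domain makes the extension to `ℝ` unique.
    · rw [x.label_of_time_le s h, y.label_of_time_le s (ht ▸ h)]

theorem le_def {x y : RealPath k₀} :
    x ≤ y ↔ x.time ≤ y.time ∧ ∀ s < x.time, x.label s = y.label s := Iff.rfl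

theorem le_iff_time_le {x y z : RealPath k₀} (hx : x ≤ z) (hy : y ≤ z) :
    x ≤ y ↔ x.time ≤ y.time :=
  ⟨fun h => h.1, fun h => ⟨h, fun s hs => (hx.2 s hs).trans (hy.2 s (hs.trans_le h)).symm⟩⟩

theorem total_of_le {x y z : RealPath k₀} (hx : x ≤ z) (hy : y ≤ z) : x ≤ y ∨ y ≤ x := by
  rw [le_iff_time_le hx hy, le_iff_time_le hy hx]
  exact le_total _ _

theorem time_lt_of_lt {x y : RealPath k₀} (h : x < y) : x.time < y.time := by
  refine lt_of_le_of_ne h.le.1 fun ht => h.not_ge ?_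
  exact (le_iff_time_le le_rfl h.le).2 ht.ge

variable (k₀) in
/-- The empty path. -/
def root : RealPath k₀ where
  time := 0
  label _ := k₀
  time_nonneg := le_rfl
  label_of_neg _ _ := rfl
  label_of_time_le _ _ := rfl
  rightConstAt := rightConstAt_const k₀

theorem root_le (x : RealPath k₀) : root k₀ ≤ x :=
  ⟨x.time_nonneg, fun s hs => (x.label_of_neg s hs).symm⟩

open Classical in
/-- The restriction of a path to `[0, r)`. -/
noncomputable def trunc (x : RealPath k₀) (r : ℝ) (hr : 0 ≤ r) : RealPath k₀ where
  time := r
  label s := if s < r then x.label s else k₀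
  time_nonneg := hr
  label_of_neg s hs := by rw [if_pos (hs.trans_le hr), x.label_of_neg s hs]
  label_of_time_le s hs := if_neg (not_lt.2 hs)
  rightConstAt := RightConstAt.glue (fun s _ => x.rightConstAt s)
    (fun s _ => rightConstAt_const k₀ s)

theorem trunc_label {x : RealPath k₀} {r s : ℝ} (hr : 0 ≤ r) (hs : s < r) :
    (x.trunc r hr).label s = x.label s := if_pos hs

theorem trunc_le {x : RealPath k₀} {r : ℝ} (hr : 0 ≤ r) (h : r ≤ x.time) : x.trunc r hr ≤ x :=
  ⟨h, fun _ hs => trunc_label hr hs⟩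

theorem le_trunc {x y : RealPath k₀} {r : ℝ} (hr : 0 ≤ r) (h : x ≤ y) (hx : x.time ≤ r) :
    x ≤ y.trunc r hr :=
  ⟨hx, fun s hs => (h.2 s hs).trans (trunc_label hr (hs.trans_le hx)).symm⟩

open Classical in
/-- Continue the path `x` up to time `b` by the labels `σ`. -/
noncomputable def graft (x : RealPath k₀) (b : ℝ) (hb : x.time ≤ b) (σ : ℝ → K)
    (hσ : ∀ s < b, RightConstAt σ s) : RealPath k₀ where
  time := b
  label s := if s < x.time then x.label s else if s < b then σ s else k₀
  time_nonneg := x.time_nonneg.trans hb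
  label_of_neg s hs := by rw [if_pos (hs.trans_le x.time_nonneg), x.label_of_neg s hs]
  label_of_time_le s hs := by rw [if_neg (not_lt.2 (hb.trans hs)), if_neg (not_lt.2 hs)]
  rightConstAt := RightConstAt.glue (fun s _ => x.rightConstAt s) fun s _ =>
    RightConstAt.glue hσ (fun s _ => rightConstAt_const k₀ s) s

section graft

variable {x : RealPath k₀} {b : ℝ} {hb : x.time ≤ b} {σ : ℝ → K}
  {hσ : ∀ s < b, RightConstAt σ s}

theorem le_graft : x ≤ x.graft b hb σ hσ := ⟨hb, fun _ hs => (if_pos hs).symm⟩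

theorem graft_label {s : ℝ} (h : x.time ≤ s) (h' : s < b) :
    (x.graft b hb σ hσ).label s = σ s := by
  simp [graft, not_lt.2 h, h']

end graft

/-- Continue a path by a constant label for one unit of time. -/
noncomputable def extend (x : RealPath k₀) (k : K) : RealPath k₀ :=
  x.graft (x.time + 1) (by linarith) (fun _ => k) fun s _ => rightConstAt_const k s

theorem extend_label (x : RealPath k₀) (k : K) {s : ℝ} (h : x.time ≤ s) (h' : s < x.time + 1) :
    (x.extend k).label s = k := graft_label h h'

theorem lt_extend (x : RealPath k₀) (k : K) : x < x.extend k := by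
  refine lt_of_le_of_ne le_graft fun h => ?_
  have : x.time = x.time + 1 := congrArg time h
  linarith

/-- Domains are half-open, so the supremum of the times of agreement is itself a time of agreement.
-/
theorem exists_meet (x y : RealPath k₀) :
    ∃ m : RealPath k₀, IsGreatest {z : RealPath k₀ | z ≤ x ∧ z ≤ y} m := by
  set R : Set ℝ := {r | 0 ≤ r ∧ r ≤ x.time ∧ r ≤ y.time ∧ ∀ s < r, x.label s = y.label s}
  have h0 : (0 : ℝ) ∈ R := ⟨le_rfl, x.time_nonneg, y.time_nonneg, fun s hs => by
    rw [x.label_of_neg s hs, y.label_of_neg s hs]⟩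
  have hbdd : BddAbove R := ⟨x.time, fun r hr => hr.2.1⟩
  have hr0 : 0 ≤ sSup R := le_csSup hbdd h0
  have hagree : ∀ s < sSup R, x.label s = y.label s := fun s hs => by
    obtain ⟨r, hr, hsr⟩ := exists_lt_of_lt_csSup ⟨0, h0⟩ hs
    exact hr.2.2.2 s hsr
  have hx : x.trunc (sSup R) hr0 ≤ x := trunc_le _ (csSup_le ⟨0, h0⟩ fun r hr => hr.2.1)
  refine ⟨x.trunc (sSup R) hr0, ⟨hx, csSup_le ⟨0, h0⟩ fun r hr => hr.2.2.1, fun s hs => ?_⟩, ?_⟩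
  · exact (trunc_label hr0 hs).trans (hagree s hs)
  · rintro z ⟨hzx, hzy⟩
    exact le_trunc _ hzx (le_csSup hbdd ⟨z.time_nonneg, hzx.1, hzy.1, fun s hs =>
      (hzx.2 s hs).symm.trans (hzy.2 s hs)⟩)

/-! ### Subtrees cut out by a set of paths -/

/-- The path is constant on some interval `[s, time)` with `s < time`. -/
def LeftConst (x : RealPath k₀) : Prop :=
  ∃ s < x.time, ∀ u ∈ Set.Ico s x.time, x.label u = x.label s

theorem leftConst_root : (root k₀).LeftConst := ⟨-1, by simp [root], fun _ _ => rfl⟩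

/-- The paths all of whose restrictions lie in `A`. -/
def Hereditary (A : Set (RealPath k₀)) : Type u := {x : RealPath k₀ // ∀ y ≤ x, y ∈ A}

namespace Hereditary

variable {A : Set (RealPath k₀)}

instance : PartialOrder (Hereditary A) := inferInstanceAs (PartialOrder (Subtype _))

/-- The element of the subtree given by a path below one of its elements. -/
def ofLE (x : Hereditary A) (y : RealPath k₀) (h : y ≤ x.1) : Hereditary A :=
  ⟨y, fun z hz => x.2 z (hz.trans h)⟩

theorem le_iff_time_le {x y z : Hereditary A} (hx : x ≤ z) (hy : y ≤ z) :
    x ≤ y ↔ x.1.time ≤ y.1.time := RealPath.le_iff_time_le (z := z.1) hx hy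

theorem total_of_le {x y z : Hereditary A} (hx : x ≤ z) (hy : y ≤ z) : x ≤ y ∨ y ≤ x :=
  RealPath.total_of_le (z := z.1) hx hy

theorem time_lt_of_lt {x y : Hereditary A} (h : x < y) : x.1.time < y.1.time :=
  RealPath.time_lt_of_lt (x := x.1) (y := y.1) h

theorem exists_time_eq (x : Hereditary A) {r : ℝ} (h0 : 0 ≤ r) (h : r ≤ x.1.time) :
    ∃ y ≤ x, y.1.time = r :=
  ⟨x.ofLE _ (trunc_le h0 h), trunc_le h0 h, rfl⟩

variable (hA : ∀ x : RealPath k₀, x.LeftConst → x ∈ A)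
include hA

/-- A restriction of the extension lies below `x` or ends inside the constant piece. -/
theorem extend_mem (x : Hereditary A) (k : K) : ∀ y ≤ x.1.extend k, y ∈ A := by
  intro y hy
  rcases le_or_gt y.time x.1.time with h | h
  · exact x.2 y ((RealPath.le_iff_time_le hy (lt_extend _ _).le).2 h)
  · refine hA y ⟨x.1.time, h, fun u hu => ?_⟩
    have h1 : y.time ≤ x.1.time + 1 := hy.1
    rw [hy.2 u hu.2, hy.2 _ h, extend_label _ _ hu.1 (hu.2.trans_le h1),
      extend_label _ _ le_rfl (h.trans_le h1)]

theorem isTreeOrder : IsTreeOrder (Hereditary A) where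
  isChain_Iic x _ hy _ hz _ := total_of_le hy hz
  exists_root := by
    refine ⟨⟨root k₀, fun y hy => ?_⟩, fun x => root_le x.1⟩
    rw [le_antisymm hy (root_le y)]
    exact hA _ leftConst_root

omit hA in
theorem exists_meet (x y : Hereditary A) :
    ∃ m : Hereditary A, IsGreatest {z : Hereditary A | z ≤ x ∧ z ≤ y} m := by
  obtain ⟨m, hm, hmax⟩ := RealPath.exists_meet x.1 y.1
  exact ⟨x.ofLE m hm.1, hm, fun z hz => hmax hz⟩

theorem isBranchwiseRealTree : IsBranchwiseRealTree (Hereditary A) where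
  toIsTreeOrder := isTreeOrder hA
  exists_meet := exists_meet
  branch_iso_interval B hB := by
    have hle : ∀ x ∈ B, ∀ y ∈ B, (x.1.time ≤ y.1.time ↔ x ≤ y) := fun x hx y hy => by
      rcases hB.1.total hx hy with h | h
      · exact (le_iff_time_le h le_rfl).symm
      · exact (le_iff_time_le le_rfl h).symm
    refine ⟨(fun x : Hereditary A => x.1.time) '' B, ⟨?_⟩, ⟨?_⟩⟩
    · rintro _ ⟨x, hx, rfl⟩ _ ⟨y, hy, rfl⟩ t ⟨ht, ht'⟩
      obtain ⟨z, hz, rfl⟩ := exists_time_eq y (x.1.time_nonneg.trans ht) ht'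
      refine ⟨z, ?_, rfl⟩
      -- A restriction of a member of the branch is comparable to all its members, so maximality
      -- puts it in the branch.
      by_contra hzB
      refine hzB (hB.2 (hB.1.insert fun w hw _ => ?_) (Set.subset_insert z B) ▸
        Set.mem_insert z B)
      rcases hB.1.total hw hy with h | h
      · exact total_of_le hz h
      · exact Or.inl (hz.trans h)
    · let g : B ↪o (fun x : Hereditary A => x.1.time) '' B :=
        OrderEmbedding.ofMapLEIff (fun x => ⟨x.1.1.time, x.1, x.2, rfl⟩)
          fun x y => hle x.1 x.2 y.1 y.2
      exact RelIso.ofSurjective g fun ⟨_, x, hx, ht⟩ => ⟨⟨x, hx⟩, Subtype.ext ht⟩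

omit hA in
theorem isContinuousGrading_time : IsContinuousGrading fun x : Hereditary A => x.1.time := by
  refine ⟨fun x y => time_lt_of_lt, fun x y hxy => ?_⟩
  have hle : ∀ z ∈ Set.Icc x y, ∀ w ∈ Set.Icc x y, (z.1.time ≤ w.1.time ↔ z ≤ w) :=
    fun z hz w hw => (le_iff_time_le hz.2 hw.2).symm
  let g : Set.Icc x y ↪o Set.Icc x.1.time y.1.time :=
    OrderEmbedding.ofMapLEIff (fun z => ⟨z.1.1.time, z.2.1.1, z.2.2.1⟩)
      fun z w => hle z.1 z.2 w.1 w.2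
  refine ⟨RelIso.ofSurjective g ?_, fun z => rfl⟩
  rintro ⟨t, ht, ht'⟩
  obtain ⟨z, hz, rfl⟩ := exists_time_eq y (x.1.time_nonneg.trans ht) ht'
  exact ⟨⟨z, (le_iff_time_le hxy.le hz).2 ht, hz⟩, rfl⟩

omit hA in
theorem label_eq_of_le {x w y : Hereditary A} (h : x < w) (hy : w ≤ y) :
    w.1.label x.1.time = y.1.label x.1.time := hy.2 _ (time_lt_of_lt h)

/-- Two paths above `x` with the same label at `x.time` agree a little longer, by local constancy to
the right, and so share a component. -/
theorem degree_eq [IsTreeOrder (Hereditary A)] (x : Hereditary A) :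
    degree x = Cardinal.mk K := by
  refine Cardinal.mk_congr (Equiv.ofBijective
    (Quotient.lift (fun y : Set.Ioi x => y.1.1.label x.1.time) ?_) ⟨?_, ?_⟩)
  · rintro y z ⟨w, hw, hwy, hwz⟩
    exact (label_eq_of_le hw hwy).symm.trans (label_eq_of_le hw hwz)
  · rintro ⟨y, hy⟩ ⟨z, hz⟩ h
    replace h : y.1.label x.1.time = z.1.label x.1.time := h
    refine Quotient.sound ?_
    obtain ⟨u, hu, Hu⟩ := y.1.rightConstAt x.1.time
    obtain ⟨v, hv, Hv⟩ := z.1.rightConstAt x.1.time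
    have hty := time_lt_of_lt hy
    have htz := time_lt_of_lt hz
    set b := min (min u v) (min y.1.time z.1.time)
    have hb : x.1.time < b := lt_min (lt_min hu hv) (lt_min hty htz)
    have hby : b ≤ y.1.time := (min_le_right _ _).trans (min_le_left _ _)
    have hbz : b ≤ z.1.time := (min_le_right _ _).trans (min_le_right _ _)
    obtain ⟨w, hw, hwb⟩ := exists_time_eq y (x.1.time_nonneg.trans hb.le) hby
    have hxw : x ≤ w := (le_iff_time_le (le_of_lt hy) hw).2 (hb.le.trans_eq hwb.symm)
    refine ⟨w, lt_of_le_of_ne hxw fun h => hb.ne (h ▸ hwb), hw,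
      hwb.trans_le hbz, fun s hs => (hw.2 s hs).trans ?_⟩
    rw [hwb] at hs
    rcases lt_or_ge s x.1.time with h' | h'
    · exact ((le_of_lt hy : x ≤ y).2 s h').symm.trans ((le_of_lt hz : x ≤ z).2 s h')
    · rw [Hu s ⟨h', hs.trans_le ((min_le_left _ _).trans (min_le_left _ _))⟩,
        Hv s ⟨h', hs.trans_le ((min_le_left _ _).trans (min_le_right _ _))⟩, h]
  · intro k
    exact ⟨⟦⟨⟨x.1.extend k, extend_mem hA x k⟩, lt_extend x.1 k⟩⟧,
      extend_label x.1 k le_rfl (by linarith)⟩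

/-- Let `z` leave the path towards `f x` at `x`. Then `f z` is above `f x`, so `z` and `f z` differ
at time `x.time`. -/
theorem exists_incomparable_of_lt [Nontrivial K] (f : Hereditary A ≃o Hereditary A)
    {x : Hereditary A} (h : x < f x) : ∃ z, ¬ z ≤ f z ∧ ¬ f z ≤ z := by
  obtain ⟨k, hk⟩ := exists_ne ((f x).1.label x.1.time)
  let z : Hereditary A := ⟨x.1.extend k, extend_mem hA x k⟩
  have hxz : x < z := lt_extend x.1 k
  have hz : z.1.label x.1.time = k := extend_label x.1 k le_rfl (by linarith)
  have hfz : f x ≤ f z := (f.lt_iff_lt.2 hxz).le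
  have key : ∀ w, z ≤ w → f x ≤ w → False := fun w h1 h2 =>
    hk (hz.symm.trans ((label_eq_of_le hxz h1).trans (label_eq_of_le h h2).symm))
  exact ⟨z, fun h1 => key _ h1 hfz, fun h1 => key _ le_rfl (hfz.trans h1)⟩

theorem exists_incomparable [Nontrivial K] (f : Hereditary A ≃o Hereditary A)
    (hf : f ≠ OrderIso.refl _) : ∃ z, ¬ z ≤ f z ∧ ¬ f z ≤ z := by
  obtain ⟨x, hx⟩ : ∃ x, f x ≠ x := by
    by_contra! h
    exact hf (OrderIso.ext (funext h))
  by_cases h1 : x ≤ f x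
  · exact exists_incomparable_of_lt hA f (lt_of_le_of_ne h1 hx.symm)
  by_cases h2 : f x ≤ x
  · have h3 : f x < f.symm (f x) := by
      rw [f.symm_apply_apply]
      exact lt_of_le_of_ne h2 hx
    obtain ⟨z, hz, hz'⟩ := exists_incomparable_of_lt hA f.symm h3
    exact ⟨f.symm z, by rwa [f.apply_symm_apply], by rwa [f.apply_symm_apply]⟩
  · exact ⟨x, h1, h2⟩

end Hereditary
end RealPath
end BranchwiseReal

/-! ### Diagonalization and ranks of labels -/

namespace BranchwiseReal

open Cardinal in
/-- Diagonalization: given tasks `τ`, each with continuum many pairs of a point `d τ a` and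
a target `h τ a ≠ d τ a`, there is a set that separates one pair of each task. Only `𝔠` many tasks
have a given rank, and the points of a task do not occur in tasks of smaller rank. -/
theorem exists_separating_set {T E : Type u} (r : T → Ordinal.{u})
    (hr : ∀ ν, #{τ // r τ = ν} ≤ 𝔠) (d h : T → (ℕ → Bool) → E)
    (hd : ∀ τ, Function.Injective (d τ)) (hne : ∀ τ a, h τ a ≠ d τ a)
    (hlow : ∀ τ τ' a a', r τ' < r τ → d τ a ≠ d τ' a' ∧ d τ a ≠ h τ' a') (P : Set E) :
    ∃ A : Set E, (∀ e, (∀ τ a, d τ a ≠ e) → (e ∈ A ↔ e ∈ P)) ∧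
      ∀ τ, ∃ a, (d τ a ∈ A ↔ h τ a ∉ A) := by
  classical
  let W := (𝔠 : Cardinal.{u}).ord.ToType
  have hW : #W = 𝔠 := mk_ord_toType _
  have hi : ∀ ν, ∃ i : {τ // r τ = ν} → W, Function.Injective i := fun ν => by
    have : #{τ // r τ = ν} ≤ #W := (hr ν).trans_eq hW.symm
    obtain ⟨i⟩ := this
    exact ⟨i, i.injective⟩
  choose i hi using hi
  let j : T → Ordinal.{u} ×ₗ W := fun τ => toLex (r τ, i _ ⟨τ, rfl⟩)
  have hj : Function.Injective j := fun τ τ' h => by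
    have h1 : r τ = r τ' := congrArg (fun p => (ofLex p).1) h
    have h2 : i _ ⟨τ, rfl⟩ = i _ ⟨τ', rfl⟩ := congrArg (fun p => (ofLex p).2) h
    have h3 : ∀ ν (e : r τ = ν), i _ ⟨τ, rfl⟩ = i ν ⟨τ, e⟩ := by rintro _ rfl; rfl
    rw [h3 _ h1] at h2
    exact congrArg Subtype.val (hi _ h2)
  have wf : WellFounded fun τ' τ => j τ' < j τ := InvImage.wf j wellFounded_lt
  -- Tasks of smaller rank never conflict. The earlier tasks of equal rank embed in a proper initial
  -- segment of `𝔠.ord`, so they exclude fewer than `𝔠` points.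
  have hchoose : ∀ τ (c : ∀ τ', j τ' < j τ → ℕ → Bool), ∃ a, ∀ τ' (hτ : j τ' < j τ),
      d τ a ≠ d τ' (c τ' hτ) ∧ d τ a ≠ h τ' (c τ' hτ) := by
    intro τ c
    let S := {τ' // j τ' < j τ ∧ r τ' = r τ}
    have hS : #S < 𝔠 := by
      let w := i _ ⟨τ, rfl⟩
      have : #S ≤ #(Set.Iio w) := by
        refine mk_le_of_injective (f := fun τ' => ⟨i _ ⟨τ'.1, τ'.2.2⟩, ?_⟩) ?_
        · have h1 := τ'.2.1
          have h3 : ∀ ν (e : r τ'.1 = ν), i _ ⟨τ'.1, rfl⟩ = i ν ⟨τ'.1, e⟩ := by rintro _ rfl; rfl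
          rw [Prod.Lex.toLex_lt_toLex] at h1
          rcases h1 with h1 | ⟨_, h1⟩
          · exact absurd τ'.2.2 h1.ne
          · rwa [← h3]
        · intro τ₁ τ₂ h
          have := hi _ (congrArg Subtype.val h)
          exact Subtype.ext (congrArg (fun x : {τ' // r τ' = r τ} => x.1) this)
      exact this.trans_lt ((mk_Iio_lt w (by simp [W])).trans_eq hW)
    let bad : Set E := (Set.range fun s : S => d s.1 (c s.1 s.2.1)) ∪
      Set.range fun s : S => h s.1 (c s.1 s.2.1)
    have hbad : #bad < 𝔠 := by
      refine (mk_union_le _ _).trans_lt (add_lt_of_lt aleph0_le_continuum ?_ ?_)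
      · exact mk_range_le.trans_lt hS
      · exact mk_range_le.trans_lt hS
    obtain ⟨a, ha⟩ : ∃ a, d τ a ∉ bad := by
      by_contra! hall
      refine hbad.not_ge ?_
      have : lift.{u} #(ℕ → Bool) ≤ lift.{0} #bad :=
        lift_mk_le_lift_mk_of_injective (f := fun a => (⟨d τ a, hall a⟩ : bad))
          fun a b hab => hd τ (congrArg Subtype.val hab)
      simpa using this
    refine ⟨a, fun τ' hτ => ?_⟩
    by_cases hrr : r τ' = r τ
    · exact ⟨fun e => ha (Or.inl ⟨⟨τ', hτ, hrr⟩, e.symm⟩),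
        fun e => ha (Or.inr ⟨⟨τ', hτ, hrr⟩, e.symm⟩)⟩
    · refine hlow _ _ _ _ ?_
      rcases Prod.Lex.toLex_lt_toLex.1 hτ with h1 | h1
      · exact h1
      · exact absurd h1.1 hrr
  choose pick hpick using hchoose
  let a : T → ℕ → Bool := wf.fix pick
  have ha : ∀ τ τ', j τ' < j τ → d τ (a τ) ≠ d τ' (a τ') ∧ d τ (a τ) ≠ h τ' (a τ') := by
    intro τ τ' hτ
    have := hpick τ (fun τ' _ => a τ') τ' hτ
    rwa [show a τ = pick τ fun τ' _ => a τ' from wf.fix_eq pick τ]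
  have hinj : ∀ τ τ', d τ (a τ) = d τ' (a τ') → τ = τ' := by
    intro τ τ' e
    rcases lt_trichotomy (j τ) (j τ') with h1 | h1 | h1
    · exact absurd e.symm (ha _ _ h1).1
    · exact hj h1
    · exact absurd e (ha _ _ h1).1
  -- The chosen point gets the opposite status of its target. That status is already known: the
  -- target is not chosen by `τ` or later, so it was chosen earlier or keeps its default status from
  -- `P`.
  let step : ∀ τ, (∀ τ', j τ' < j τ → Prop) → Prop := fun τ c =>
    ¬ ((∃ τ', ∃ hτ : j τ' < j τ, d τ' (a τ') = h τ (a τ) ∧ c τ' hτ) ∨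
      ((∀ τ', d τ' (a τ') ≠ h τ (a τ)) ∧ h τ (a τ) ∈ P))
  let col : T → Prop := wf.fix step
  have hcol : ∀ τ, col τ ↔ ¬ ((∃ τ', ∃ _ : j τ' < j τ, d τ' (a τ') = h τ (a τ) ∧ col τ') ∨
      ((∀ τ', d τ' (a τ') ≠ h τ (a τ)) ∧ h τ (a τ) ∈ P)) := fun τ => by
    have : col τ = step τ fun τ' _ => col τ' := wf.fix_eq step τ
    rw [this]
  refine ⟨{e | (∃ τ, d τ (a τ) = e ∧ col τ) ∨ ((∀ τ, d τ (a τ) ≠ e) ∧ e ∈ P)}, ?_, ?_⟩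
  · intro e he
    simp [he]
  · intro τ
    refine ⟨a τ, ?_⟩
    have h1 : d τ (a τ) ∈ {e | (∃ τ, d τ (a τ) = e ∧ col τ) ∨ ((∀ τ, d τ (a τ) ≠ e) ∧ e ∈ P)} ↔
        col τ := by
      constructor
      · rintro (⟨τ', e, hc⟩ | ⟨hn, -⟩)
        · rwa [← hinj _ _ e]
        · exact absurd rfl (hn τ)
      · exact fun hc => Or.inl ⟨τ, rfl, hc⟩
    rw [h1, hcol, Set.mem_ofPred_eq]
    refine not_congr (or_congr ⟨fun ⟨τ', _, e⟩ => ⟨τ', e⟩, fun ⟨τ', e, hc⟩ => ?_⟩ Iff.rfl)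
    refine ⟨τ', ?_, e, hc⟩
    rcases lt_trichotomy (j τ) (j τ') with h2 | h2 | h2
    · exact absurd e (ha _ _ h2).2
    · obtain rfl := hj h2
      exact absurd e.symm (hne _ _)
    · exact h2

open Cardinal in
/-- A set of at most `𝔠⁺` elements can be ranked such that at most `𝔠` elements lie weakly below
any given one, and any `𝔠` elements have an upper bound. -/
theorem exists_rank {K : Type u} [Nonempty K] (hK : #K ≤ Order.succ 𝔠) :
    ∃ rk : K → Ordinal.{u}, (∀ k, #{k' | rk k' ≤ rk k} ≤ 𝔠) ∧
      ∀ C : Set K, #C ≤ 𝔠 → ∃ k, ∀ c ∈ C, rk c ≤ rk k := by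
  rcases hK.lt_or_eq with hK | hK
  · exact ⟨fun _ => 0, fun k => (mk_set_le _).trans (Order.lt_succ_iff.1 hK),
      fun C _ => ⟨Classical.arbitrary K, fun _ _ => le_rfl⟩⟩
  · have hreg : Cardinal.IsRegular (Order.succ (𝔠 : Cardinal.{u})) := isRegular_succ aleph0_le_continuum
    obtain ⟨e⟩ : Nonempty (K ≃ (Order.succ (𝔠 : Cardinal.{u})).ord.ToType) := by
      rw [← Cardinal.eq, mk_ord_toType, hK]
    let rk : K → Ordinal.{u} := fun k => (Ordinal.ToType.mk.symm (e k)).1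
    have hrk : ∀ k, rk k < (Order.succ (𝔠 : Cardinal.{u})).ord :=
      fun k => (Ordinal.ToType.mk.symm (e k)).2
    have hle : ∀ k k', rk k' ≤ rk k ↔ e k' ≤ e k := fun k k' => by
      simp [rk]
    refine ⟨rk, fun k => ?_, fun C hC => ?_⟩
    · have h1 : #{k' | rk k' ≤ rk k} ≤ #(Set.Iic (e k)) := by
        refine mk_le_of_injective (f := fun k' => ⟨e k'.1, (hle _ _).1 k'.2⟩) fun a b hab => ?_
        exact Subtype.ext (e.injective (congrArg Subtype.val hab))
      refine h1.trans (Order.lt_succ_iff.1 ?_)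
      rw [← Set.Iio_union_right]
      refine (mk_union_le _ _).trans_lt (add_lt_of_lt hreg.aleph0_le ((mk_Iio_lt _ (by simp)).trans_eq (mk_ord_toType _)) ?_)
      simpa using one_lt_aleph0.trans_le hreg.aleph0_le
    · have h1 : (⨆ c : C, rk c) < (Order.succ (𝔠 : Cardinal.{u})).ord :=
        Ordinal.iSup_lt_of_lt_cof (by rw [hreg.cof_ord]; exact Order.lt_succ_iff.2 hC) fun c => hrk c
      refine ⟨e.symm (Ordinal.ToType.mk ⟨_, h1⟩), fun c hc => ?_⟩
      have : rk (e.symm (Ordinal.ToType.mk ⟨_, h1⟩)) = ⨆ c : C, rk c := by simp [rk]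
      rw [this]
      exact Ordinal.le_iSup (fun c : C => rk c) ⟨c, hc⟩

end BranchwiseReal

/-! ### Zigzag paths and their stages -/

namespace BranchwiseReal

namespace RealPath

variable {K : Type u} {k₀ : K}

theorem rightConstAt_floor (σ : ℕ → K) {c s : ℝ} (hs : s < c) :
    RightConstAt (fun s => σ ⌊1 / (c - s)⌋₊) s := by
  have hpos : 0 < c - s := sub_pos.2 hs
  set n := ⌊1 / (c - s)⌋₊
  have hn : 1 / (c - s) < n + 1 := Nat.lt_floor_add_one _
  have hn' : (n : ℝ) ≤ 1 / (c - s) := Nat.floor_le (by positivity)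
  have hn0 : (0 : ℝ) < n + 1 := by positivity
  -- This is the time at which the floor jumps to `n + 1`.
  refine ⟨c - 1 / (n + 1), ?_, fun u hu => congrArg σ ?_⟩
  · have := (one_div_lt hpos hn0).1 hn
    linarith
  · have h1 : 1 / ((n : ℝ) + 1) < c - u := by linarith [hu.2]
    have hu0 : 0 < c - u := lt_trans (by positivity) h1
    refine (Nat.floor_eq_iff (by positivity)).2 ⟨hn'.trans ?_, (one_div_lt hn0 hu0).1 h1⟩
    exact one_div_le_one_div_of_le hu0 (by linarith [hu.1])

/-- Continue a path for one unit of time by a sequence of labels, which change at times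
accumulating at the end. -/
noncomputable def zigzag (x : RealPath k₀) (σ : ℕ → K) : RealPath k₀ :=
  x.graft (x.time + 1) (by linarith) (fun s => σ ⌊1 / (x.time + 1 - s)⌋₊)
    fun _ => rightConstAt_floor σ

theorem zigzag_label (x : RealPath k₀) (σ : ℕ → K) {s : ℝ} (h : x.time ≤ s)
    (h' : s < x.time + 1) : (x.zigzag σ).label s = σ ⌊1 / (x.time + 1 - s)⌋₊ :=
  graft_label h h'

theorem zigzag_label_nat (x : RealPath k₀) (σ : ℕ → K) {m : ℕ} (hm : 1 ≤ m) :
    (x.zigzag σ).label (x.time + 1 - 1 / m) = σ m := by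
  have hm' : (1 : ℝ) ≤ m := by exact_mod_cast hm
  have h1 : (1 : ℝ) / m ≤ 1 := by
    rw [div_le_one (by linarith)]
    exact hm'
  have h2 : (0 : ℝ) < 1 / m := by positivity
  rw [zigzag_label _ _ (by linarith) (by linarith)]
  simp

theorem le_zigzag (x : RealPath k₀) (σ : ℕ → K) : x ≤ x.zigzag σ := le_graft

/-- The jumps accumulate only at the end of the zigzag. -/
theorem le_or_leftConst_of_lt_zigzag {x y : RealPath k₀} {σ : ℕ → K} (h : y < x.zigzag σ) :
    y ≤ x ∨ y.LeftConst := by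
  rcases le_or_gt y.time x.time with hyx | hyx
  · exact Or.inl ((RealPath.le_iff_time_le h.le (le_zigzag x σ)).2 hyx)
  right
  have hy : y.time < x.time + 1 := time_lt_of_lt h
  have hpos : 0 < x.time + 1 - y.time := sub_pos.2 hy
  have h1 : 1 < 1 / (x.time + 1 - y.time) := by
    rw [lt_div_iff₀ hpos]
    linarith
  -- The index just before `y.time` is the ceiling minus one; the floor would be wrong if `y` ends
  -- at a jump.
  obtain ⟨m, hm⟩ : ∃ m, ⌈1 / (x.time + 1 - y.time)⌉₊ = m + 1 :=
    Nat.exists_eq_succ_of_ne_zero (Nat.ceil_pos.2 (by positivity)).ne'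
  have hm1 : (m : ℝ) < 1 / (x.time + 1 - y.time) := Nat.lt_ceil.1 (by omega)
  have hm2 : 1 / (x.time + 1 - y.time) ≤ (m + 1 : ℕ) := hm ▸ Nat.le_ceil _
  have hm0 : 0 < m := by
    rcases Nat.eq_zero_or_pos m with rfl | h0
    · norm_num at hm2 h1
      linarith
    · exact h0
  have hm0' : (0 : ℝ) < m := by exact_mod_cast hm0
  have hv : x.time + 1 - 1 / m < y.time := by
    have := (lt_one_div hm0' hpos).1 hm1
    linarith
  have key : ∀ u ∈ Set.Ico (max x.time (x.time + 1 - 1 / m)) y.time,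
      y.label u = σ m := fun u hu => by
    have hux := (le_max_left _ _).trans hu.1
    have hum := (le_max_right _ _).trans hu.1
    have hu0 : 0 < x.time + 1 - u := by linarith [hu.2]
    rw [h.le.2 u hu.2, zigzag_label _ _ hux (hu.2.trans hy)]
    refine congrArg σ ((Nat.floor_eq_iff (by positivity)).2 ⟨?_, ?_⟩)
    · exact (le_one_div hu0 hm0').1 (by linarith)
    · push_cast at hm2
      refine lt_of_lt_of_le ?_ hm2
      exact one_div_lt_one_div_of_lt hpos (by linarith [hu.2])
  have hmax := max_lt hyx hv
  exact ⟨_, hmax, fun u hu => (key u hu).trans (key _ ⟨le_rfl, hmax⟩).symm⟩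

theorem zigzag_not_leftConst (x : RealPath k₀) {σ : ℕ → K}
    (hσ : ∀ n, σ (3 * n + 1) ≠ σ (3 * n + 2)) : ¬ (x.zigzag σ).LeftConst := by
  rintro ⟨s, hs, H⟩
  replace hs : s < x.time + 1 := hs
  obtain ⟨n, hn⟩ := exists_nat_one_div_lt (sub_pos.2 hs)
  have hlab : ∀ m, n + 1 ≤ m → σ m = (x.zigzag σ).label s := fun m hm => by
    rw [← zigzag_label_nat x σ (by omega : 1 ≤ m)]
    have h0 : (0 : ℝ) < n + 1 := by positivity
    have h1 : ((n : ℝ) + 1) ≤ m := by exact_mod_cast hm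
    have h2 : (1 : ℝ) / m ≤ 1 / (n + 1) := one_div_le_one_div_of_le h0 h1
    have h3 : (0 : ℝ) < 1 / m := by
      have := h0.trans_le h1
      positivity
    exact H _ ⟨by linarith, by change _ < x.time + 1; linarith⟩
  exact hσ n ((hlab _ (by omega)).trans (hlab _ (by omega)).symm)

theorem stage_time_nonneg (x : RealPath k₀) (n : ℕ) :
    0 ≤ x.time + 1 - 1 / ((3 * n + 1 : ℕ) : ℝ) := by
  have h : (1 : ℝ) / ((3 * n + 1 : ℕ) : ℝ) ≤ 1 := by
    rw [div_le_one (by positivity)]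
    exact_mod_cast Nat.le_add_left 1 _
  linarith [x.time_nonneg]

/-- The initial part of `x.zigzag σ` that uses the labels `σ m` for `m ≤ 3 * n` only. -/
noncomputable def stage (x : RealPath k₀) (σ : ℕ → K) (n : ℕ) : RealPath k₀ :=
  (x.zigzag σ).trunc (x.time + 1 - 1 / ((3 * n + 1 : ℕ) : ℝ)) (x.stage_time_nonneg n)

theorem stage_lt_zigzag (x : RealPath k₀) (σ : ℕ → K) (n : ℕ) : x.stage σ n < x.zigzag σ := by
  have h : (0 : ℝ) < 1 / ((3 * n + 1 : ℕ) : ℝ) := by positivity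
  have h' : x.time + 1 - 1 / ((3 * n + 1 : ℕ) : ℝ) < x.time + 1 := by linarith
  exact lt_of_le_of_ne (trunc_le _ h'.le) fun e => h'.ne (congrArg time e)

theorem le_stage (x : RealPath k₀) (σ : ℕ → K) (n : ℕ) : x ≤ x.stage σ n := by
  refine le_trunc _ (le_zigzag x σ) ?_
  have h : (1 : ℝ) / ((3 * n + 1 : ℕ) : ℝ) ≤ 1 := by
    rw [div_le_one (by positivity)]
    exact_mod_cast Nat.le_add_left 1 _
  linarith

theorem stage_label (x : RealPath k₀) (σ : ℕ → K) (n : ℕ) {s : ℝ} (hs : x.time ≤ s)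
    (hs' : s < (x.stage σ n).time) :
    ⌊1 / (x.time + 1 - s)⌋₊ ≤ 3 * n ∧
      (x.stage σ n).label s = σ ⌊1 / (x.time + 1 - s)⌋₊ := by
  have hs'' : s < x.time + 1 := hs'.trans (time_lt_of_lt (stage_lt_zigzag x σ n))
  constructor
  · have hpos : 0 < x.time + 1 - s := sub_pos.2 hs''
    have h1 : s < x.time + 1 - 1 / ((3 * n + 1 : ℕ) : ℝ) := hs'
    have h2 : 1 / (x.time + 1 - s) < ((3 * n + 1 : ℕ) : ℝ) :=
      (one_div_lt (by positivity) hpos).1 (by linarith)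
    exact Nat.lt_succ_iff.1 ((Nat.floor_lt (by positivity)).2 h2)
  · rw [(stage_lt_zigzag x σ n).le.2 s hs', zigzag_label _ _ hs hs'']

theorem stage_congr (x : RealPath k₀) {σ τ : ℕ → K} {n : ℕ} (h : ∀ m ≤ 3 * n, σ m = τ m) :
    x.stage σ n = x.stage τ n := by
  refine le_antisymm (le_def.2 ⟨le_rfl, fun s hs => ?_⟩) (le_def.2 ⟨le_rfl, fun s hs => ?_⟩) <;>
  · rcases lt_or_ge s x.time with hsx | hsx
    · rw [← (le_stage x σ n).2 s hsx, ← (le_stage x τ n).2 s hsx]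
    · have h1 := stage_label x σ n hsx hs
      rw [h1.2, (stage_label x τ n hsx hs).2, h _ h1.1]

theorem zigzag_le_of_stage_le {x u : RealPath k₀} {σ : ℕ → K} (h : ∀ n, x.stage σ n ≤ u) :
    x.zigzag σ ≤ u := by
  have key : ∀ s < x.time + 1, ∃ n, s < (x.stage σ n).time := fun s hs => by
    obtain ⟨n, hn⟩ := exists_nat_one_div_lt (sub_pos.2 hs)
    refine ⟨n, ?_⟩
    change s < x.time + 1 - 1 / ((3 * n + 1 : ℕ) : ℝ)
    have : (1 : ℝ) / ((3 * n + 1 : ℕ) : ℝ) ≤ 1 / (n + 1) := by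
      refine one_div_le_one_div_of_le (by positivity) ?_
      push_cast
      linarith [(Nat.cast_nonneg n : (0 : ℝ) ≤ n)]
    linarith
  constructor
  · refine le_of_forall_lt fun s hs => ?_
    obtain ⟨n, hn⟩ := key s hs
    exact hn.trans_le (h n).1
  · intro s hs
    obtain ⟨n, hn⟩ := key s hs
    rw [← (stage_lt_zigzag x σ n).le.2 s hn, (h n).2 s hn]

/-- The labels `k n`, interleaved with the pairs `k₀, k₁` or `k₁, k₀` according to `a n`. -/
def pattern (k₀ k₁ : K) (k : ℕ → K) (a : ℕ → Bool) (m : ℕ) : K :=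
  if m % 3 = 0 then k (m / 3) else
    if m % 3 = 1 then (if a (m / 3) then k₁ else k₀) else (if a (m / 3) then k₀ else k₁)

section pattern

variable {k₁ : K} {k : ℕ → K} {a : ℕ → Bool}

theorem pattern_zero (n : ℕ) : pattern k₀ k₁ k a (3 * n) = k n := by
  simp [pattern]

theorem pattern_one (n : ℕ) : pattern k₀ k₁ k a (3 * n + 1) = if a n then k₁ else k₀ := by
  have h1 : (3 * n + 1) % 3 = 1 := by omega
  have h2 : (3 * n + 1) / 3 = n := by omega
  simp [pattern, h1, h2]

theorem pattern_two (n : ℕ) : pattern k₀ k₁ k a (3 * n + 2) = if a n then k₀ else k₁ := by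
  have h1 : (3 * n + 2) % 3 = 2 := by omega
  have h2 : (3 * n + 2) / 3 = n := by omega
  simp [pattern, h1, h2]

/-- Position `3 * n` carries a tag, so only the bits below `n` matter. -/
theorem pattern_congr {b : ℕ → Bool} {n : ℕ} (h : ∀ i < n, a i = b i) {m : ℕ}
    (hm : m ≤ 3 * n) : pattern k₀ k₁ k a m = pattern k₀ k₁ k b m := by
  unfold pattern
  split_ifs with h0
  · rfl
  all_goals
    have := h (m / 3) (by omega)
    simp_all

theorem pattern_cases {m n : ℕ} (hm : m ≤ 3 * n) :
    pattern k₀ k₁ k a m = k₀ ∨ pattern k₀ k₁ k a m = k₁ ∨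
      ∃ i ≤ n, pattern k₀ k₁ k a m = k i := by
  unfold pattern
  split_ifs
  · exact Or.inr (Or.inr ⟨m / 3, by omega, rfl⟩)
  all_goals simp

end pattern

variable {k₁ : K} {k : ℕ → K}

theorem zigzag_pattern_injective (x : RealPath k₀) (hk : k₀ ≠ k₁) :
    Function.Injective fun a => x.zigzag (pattern k₀ k₁ k a) := by
  intro a b hab
  funext n
  have h := congrArg (fun y : RealPath k₀ => y.label (x.time + 1 - 1 / ((3 * n + 1 : ℕ) : ℝ))) hab
  simp only [zigzag_label_nat x _ (by omega : 1 ≤ 3 * n + 1), pattern_one] at h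
  cases ha : a n <;> cases hb : b n <;> simp_all

theorem zigzag_pattern_not_leftConst (x : RealPath k₀) (hk : k₀ ≠ k₁) (a : ℕ → Bool) :
    ¬ (x.zigzag (pattern k₀ k₁ k a)).LeftConst := by
  refine zigzag_not_leftConst x fun n => ?_
  rw [pattern_one, pattern_two]
  cases a n
  · simpa using hk
  · simpa using hk.symm

/-- The floor is at least `1` along the zigzag, so position `0` is skipped; hence the shift to `n +
1`. -/
theorem exists_zigzag_pattern_label (x : RealPath k₀) (a : ℕ → Bool) (n : ℕ) :
    ∃ s, (x.zigzag (pattern k₀ k₁ k a)).label s = k (n + 1) :=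
  ⟨_, (zigzag_label_nat x _ (by omega : 1 ≤ 3 * (n + 1))).trans (pattern_zero (n + 1))⟩

theorem stage_pattern_label (x : RealPath k₀) (a : ℕ → Bool) (n : ℕ) (s : ℝ) :
    (∃ s', (x.stage (pattern k₀ k₁ k a) n).label s = x.label s') ∨
      (x.stage (pattern k₀ k₁ k a) n).label s = k₁ ∨
        ∃ i ≤ n, (x.stage (pattern k₀ k₁ k a) n).label s = k i := by
  -- By the default value, `k₀` counts as a label of `x`.
  have h0 : x.label x.time = k₀ := x.label_of_time_le _ le_rfl
  rcases lt_or_ge s x.time with h | h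
  · exact Or.inl ⟨s, ((le_stage x _ n).2 s h).symm⟩
  rcases lt_or_ge s (x.stage (pattern k₀ k₁ k a) n).time with h' | h'
  · obtain ⟨h1, h2⟩ := stage_label x (pattern k₀ k₁ k a) n h h'
    rw [h2]
    rcases pattern_cases (k₀ := k₀) (k₁ := k₁) (k := k) (a := a) h1 with h3 | h3 | h3
    · exact Or.inl ⟨x.time, by rw [h0, h3]⟩
    · exact Or.inr (Or.inl h3)
    · exact Or.inr (Or.inr h3)
  · exact Or.inl ⟨x.time, by rw [h0, label_of_time_le _ s h']⟩

theorem exists_label_eq_zigzag (x : RealPath k₀) (a : ℕ → Bool) (s : ℝ) :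
    ∃ n, (x.zigzag (pattern k₀ k₁ k a)).label s = (x.stage (pattern k₀ k₁ k a) n).label s := by
  rcases lt_or_ge s (x.time + 1) with h | h
  · by_contra! hne
    have hn : ∀ n, (x.stage (pattern k₀ k₁ k a) n).time ≤ s := fun n => by
      by_contra! hlt
      exact hne n ((stage_lt_zigzag x _ n).le.2 s hlt).symm
    have h2 := x.time_nonneg.trans ((le_stage x _ 0).1.trans (hn 0))
    have h3 := zigzag_le_of_stage_le fun n =>
      le_trunc h2 (stage_lt_zigzag x (pattern k₀ k₁ k a) n).le (hn n)
    exact h.not_ge h3.1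
  · refine ⟨0, ?_⟩
    rw [label_of_time_le _ s h, label_of_time_le _ s
      ((time_lt_of_lt (stage_lt_zigzag x _ 0)).le.trans h)]

/-- If no `y n` reaches past `s`, then the truncation at `s` is a smaller upper bound. -/
theorem exists_label_eq_of_isLUB {y : ℕ → RealPath k₀} {u : RealPath k₀}
    (hu : IsLUB (Set.range y) u) (s : ℝ) : ∃ n, u.label s = (y n).label s := by
  have hy : ∀ n, y n ≤ u := fun n => hu.1 ⟨n, rfl⟩
  rcases lt_or_ge s u.time with h | h
  · by_contra! hne
    have hn : ∀ n, (y n).time ≤ s := fun n => by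
      by_contra! hlt
      exact hne n ((hy n).2 s hlt).symm
    have h2 := (y 0).time_nonneg.trans (hn 0)
    have h3 : u ≤ u.trunc s h2 := hu.2 (by
      rintro _ ⟨n, rfl⟩
      exact le_trunc h2 (hy n) (hn n))
    exact h.not_ge h3.1
  · exact ⟨0, by rw [label_of_time_le _ s h, label_of_time_le _ s ((hy 0).1.trans h)]⟩

/-! ### Counting paths by their labels at rational times -/

theorem exists_rat_label_eq (x : RealPath k₀) (s : ℝ) : ∃ q : ℚ, x.label q = x.label s := by
  obtain ⟨v, hv, H⟩ := x.rightConstAt s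
  obtain ⟨q, hq, hq'⟩ := exists_rat_btwn hv
  exact ⟨q, H q ⟨hq.le, hq'⟩⟩

theorem ext_of_rat {x y : RealPath k₀} (ht : x.time = y.time)
    (h : ∀ q : ℚ, x.label q = y.label q) : x = y := by
  refine RealPath.ext ht (funext fun s => ?_)
  obtain ⟨u, hu, Hu⟩ := x.rightConstAt s
  obtain ⟨v, hv, Hv⟩ := y.rightConstAt s
  obtain ⟨q, hq, hq'⟩ := exists_rat_btwn (lt_min hu hv)
  rw [← Hu q ⟨hq.le, hq'.trans_le (min_le_left _ _)⟩,
    ← Hv q ⟨hq.le, hq'.trans_le (min_le_right _ _)⟩, h]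

open Cardinal in
theorem mk_arrow_le_continuum {ι : Type} [Countable ι] {Q : Type u} (hQ : #Q ≤ 𝔠) :
    #(ι → Q) ≤ 𝔠 := by
  rw [mk_pi, prod_const, lift_id'.{0, u}]
  calc #Q ^ lift.{u} #ι ≤ 𝔠 ^ lift.{u} #ι := power_le_power_right hQ
    _ ≤ 𝔠 ^ ℵ₀ := power_le_power_left continuum_ne_zero (by simp)
    _ = 𝔠 := continuum_power_aleph0

open Cardinal in
theorem mk_labels_mem_le {Q : Set K} (hQ : #Q ≤ 𝔠) :
    #{x : RealPath k₀ | ∀ s, x.label s ∈ Q} ≤ 𝔠 := by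
  have h : #{x : RealPath k₀ | ∀ s, x.label s ∈ Q} ≤ #(ULift.{u} ℝ × (ℚ → Q)) := by
    refine mk_le_of_injective (f := fun x => (⟨x.1.time⟩, fun q => ⟨x.1.label q, x.2 q⟩)) ?_
    intro x y hxy
    refine Subtype.ext (ext_of_rat (congrArg (fun p => p.1.down) hxy) fun q => ?_)
    exact congrArg (fun p => (p.2 q : K)) hxy
  refine h.trans ?_
  rw [mk_prod, lift_id, lift_id, ← continuum_mul_self]
  exact mul_le_mul' (by simp [mk_real]) (mk_arrow_le_continuum hQ)

end RealPath
end BranchwiseReal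

/-! ### Tasks -/

namespace BranchwiseReal

namespace RealPath

variable {K : Type u} {k₀ : K}

/-- The first `n` terms of `a`, as an index for the `n`th stage of a zigzag path. -/
def initial (a : ℕ → Bool) (n : ℕ) : Σ n, Fin n → Bool := ⟨n, fun i => a i⟩

/-- Extend a finite sequence by `false`. -/
def padFalse (p : Σ n, Fin n → Bool) (i : ℕ) : Bool := if h : i < p.1 then p.2 ⟨i, h⟩ else false

theorem padFalse_initial (a : ℕ → Bool) (n : ℕ) : ∀ i < n, padFalse (initial a n) i = a i :=
  fun i hi => by simp [padFalse, initial, hi]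

/-- The rank of a sequence of labels: the least strict upper bound of the ranks of its terms. -/
noncomputable def seqRank (rk : K → Ordinal.{u}) (k : ℕ → K) : Ordinal.{u} := ⨆ n, rk (k n) + 1

/-- Countable data that might come from an automorphism that moves the path `base` to an
incomparable path: the images of the stages of the zigzag paths above `base`. -/
structure Task (k₀ k₁ : K) (rk : K → Ordinal.{u}) where
  base : RealPath k₀
  tag : ℕ → K
  image : (Σ n, Fin n → Bool) → RealPath k₀
  monotone_tag : Monotone fun n => rk (tag n)
  rank_one_lt : rk k₁ < seqRank rk tag
  rank_base_lt : ∀ s, rk (base.label s) < seqRank rk tag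
  rank_image_lt : ∀ p s, rk ((image p).label s) < seqRank rk tag
  not_base_le : ∀ p, ¬ base ≤ image p
  not_image_le : ∀ p, ¬ image p ≤ base

namespace Task

variable {k₁ : K} {rk : K → Ordinal.{u}}

/-- The zigzag paths on which the task is tested. -/
noncomputable def test (τ : Task k₀ k₁ rk) (a : ℕ → Bool) : RealPath k₀ :=
  τ.base.zigzag (pattern k₀ k₁ τ.tag a)

open Classical in
/-- The supremum of the images of the stages of a test path, if there is one. -/
noncomputable def target (τ : Task k₀ k₁ rk) (a : ℕ → Bool) : Option (RealPath k₀) :=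
  if h : ∃ u, IsLUB (Set.range fun n => τ.image (initial a n)) u then some h.choose else none

theorem target_eq_some_iff {τ : Task k₀ k₁ rk} {a : ℕ → Bool} {u : RealPath k₀} :
    τ.target a = some u ↔ IsLUB (Set.range fun n => τ.image (initial a n)) u := by
  unfold target
  split_ifs with h
  · rw [Option.some_inj]
    exact ⟨fun e => e ▸ h.choose_spec, fun hu => h.choose_spec.unique hu⟩
  · simpa using fun hu => h ⟨u, hu⟩

/-- Otherwise `base` and an image lie below a common path and are comparable. -/
theorem target_ne_test (τ : Task k₀ k₁ rk) (a : ℕ → Bool) : τ.target a ≠ some (τ.test a) := by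
  intro h
  have h1 : τ.image (initial a 0) ≤ τ.test a := (target_eq_some_iff.1 h).1 ⟨0, rfl⟩
  rcases total_of_le h1 (le_zigzag τ.base _) with h2 | h2
  · exact τ.not_image_le _ h2
  · exact τ.not_base_le _ h2

theorem rank_test_lt (τ : Task k₀ k₁ rk) (a : ℕ → Bool) (s : ℝ) :
    rk ((τ.test a).label s) < seqRank rk τ.tag := by
  obtain ⟨n, hn⟩ := exists_label_eq_zigzag (k₁ := k₁) (k := τ.tag) τ.base a s
  rw [test, hn]
  rcases stage_pattern_label (k₁ := k₁) (k := τ.tag) τ.base a n s with ⟨s', h⟩ | h | ⟨i, -, h⟩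
  · rw [h]
    exact τ.rank_base_lt s'
  · rw [h]
    exact τ.rank_one_lt
  · rw [h]
    exact Ordinal.lt_iSup_add_one (fun n => rk (τ.tag n)) i

theorem rank_target_lt {τ : Task k₀ k₁ rk} {a : ℕ → Bool} {u : RealPath k₀}
    (h : τ.target a = some u) (s : ℝ) : rk (u.label s) < seqRank rk τ.tag := by
  obtain ⟨n, hn⟩ := exists_label_eq_of_isLUB (target_eq_some_iff.1 h) s
  rw [hn]
  exact τ.rank_image_lt _ s

theorem exists_le_rank_test (τ : Task k₀ k₁ rk) (a : ℕ → Bool) {ν : Ordinal.{u}}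
    (h : ν < seqRank rk τ.tag) : ∃ s, ν ≤ rk ((τ.test a).label s) := by
  obtain ⟨n, hn⟩ := Ordinal.lt_iSup_add_one_iff.1 h
  obtain ⟨s, hs⟩ := exists_zigzag_pattern_label (k₁ := k₁) (k := τ.tag) τ.base a n
  exact ⟨s, by rw [test, hs]; exact hn.trans (τ.monotone_tag (Nat.le_succ n))⟩

open Cardinal in
theorem mk_rank_lt_seqRank_le (hrk : ∀ k, #{k' | rk k' ≤ rk k} ≤ 𝔠) (k : ℕ → K) :
    #{k' | rk k' < seqRank rk k} ≤ 𝔠 := by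
  have h : {k' | rk k' < seqRank rk k} ⊆ ⋃ n : ULift.{u} ℕ, {k' | rk k' ≤ rk (k n.down)} := by
    intro k' hk'
    obtain ⟨n, hn⟩ := Ordinal.lt_iSup_add_one_iff.1 hk'
    exact Set.mem_iUnion.2 ⟨⟨n⟩, hn⟩
  refine (mk_le_mk_of_subset h).trans (mk_iUnion_le_sum_mk.trans ?_)
  refine (sum_le_sum _ (fun _ => 𝔠) fun n => hrk _).trans ?_
  simp

open Cardinal in
-- All labels of the task come from a countable union of sets of size at most `𝔠`, and its data are
-- countable because images are indexed by finite sequences.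
theorem mk_rank_eq_le (hrk : ∀ k, #{k' | rk k' ≤ rk k} ≤ 𝔠) (ν : Ordinal.{u}) :
    #{τ : Task k₀ k₁ rk // seqRank rk τ.tag = ν} ≤ 𝔠 := by
  rcases isEmpty_or_nonempty {τ : Task k₀ k₁ rk // seqRank rk τ.tag = ν} with he | ⟨⟨τ₀, hτ₀⟩⟩
  · simp
  let Q : Set K := {k' | rk k' < ν}
  have hQ : #Q ≤ 𝔠 := by
    have := mk_rank_lt_seqRank_le hrk τ₀.tag
    rwa [hτ₀] at this
  let V := {x : RealPath k₀ | ∀ s, x.label s ∈ Q}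
  have hV : #V ≤ 𝔠 := mk_labels_mem_le hQ
  have h : #{τ : Task k₀ k₁ rk // seqRank rk τ.tag = ν} ≤
      #(V × (ℕ → Q) × ((Σ n, Fin n → Bool) → V)) := by
    refine mk_le_of_injective (f := fun τ => ⟨⟨τ.1.base, fun s => ?_⟩,
      fun n => ⟨τ.1.tag n, ?_⟩, fun p => ⟨τ.1.image p, fun s => ?_⟩⟩) ?_
    · exact (τ.1.rank_base_lt s).trans_eq τ.2
    · exact (Ordinal.lt_iSup_add_one (fun n => rk (τ.1.tag n)) n).trans_eq τ.2
    · exact (τ.1.rank_image_lt p s).trans_eq τ.2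
    · rintro ⟨τ, hτ⟩ ⟨τ', hτ'⟩ e
      have e1 : τ.base = τ'.base := congrArg (fun x => (x.1 : RealPath k₀)) e
      have e2 : τ.tag = τ'.tag := funext fun n => congrArg (fun x => (x.2.1 n : K)) e
      have e3 : τ.image = τ'.image := funext fun p => congrArg (fun x => (x.2.2 p).1) e
      cases τ
      cases τ'
      simp only at e1 e2 e3
      subst e1 e2 e3
      rfl
  refine h.trans ?_
  simp only [mk_prod, lift_id]
  calc _ ≤ (𝔠 * (𝔠 * 𝔠) : Cardinal.{u}) :=
        mul_le_mul' hV (mul_le_mul' (mk_arrow_le_continuum hQ) (mk_arrow_le_continuum hV))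
    _ = 𝔠 := by simp

open Cardinal in
theorem exists_separating_set (hk : k₀ ≠ k₁) (hrk : ∀ k, #{k' | rk k' ≤ rk k} ≤ 𝔠) :
    ∃ A : Set (RealPath k₀), (∀ x, x.LeftConst → x ∈ A) ∧ ∀ τ : Task k₀ k₁ rk,
      ∃ a, (τ.test a ∈ A ↔ ¬ ∃ u ∈ A, τ.target a = some u) := by
  -- By default every path is in and `none`, for a missing supremum, is out. Test points are never
  -- `none` or `LeftConst`, so those keep the default.
  obtain ⟨A, hA, hsep⟩ := BranchwiseReal.exists_separating_set
    (fun τ : Task k₀ k₁ rk => seqRank rk τ.tag) (mk_rank_eq_le hrk) (fun τ a => some (τ.test a))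
    target (fun τ => (Option.some_injective _).comp (zigzag_pattern_injective τ.base hk))
    target_ne_test (fun τ τ' a a' h => by
      obtain ⟨s, hs⟩ := τ.exists_le_rank_test a h
      refine ⟨fun e => ?_, fun e => ?_⟩
      · have h1 := τ'.rank_test_lt a' s
        rw [← Option.some_injective _ e] at h1
        exact h1.not_ge hs
      · exact (rank_target_lt e.symm s).not_ge hs) {e | e ≠ none}
  refine ⟨{x | some x ∈ A}, fun x hx => ?_, fun τ => ?_⟩
  · refine (hA (some x) fun τ a e => ?_).2 (Option.some_ne_none x)
    exact zigzag_pattern_not_leftConst τ.base hk a (Option.some_injective _ e ▸ hx)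
  · obtain ⟨a, ha⟩ := hsep τ
    refine ⟨a, ha.trans (not_congr ⟨fun h => ?_, ?_⟩)⟩
    · cases hu : τ.target a with
      | none =>
        rw [hu] at h
        exact absurd rfl ((hA none fun τ a => Option.some_ne_none _).1 h)
      | some u => exact ⟨u, (by rwa [hu] at h), rfl⟩
    · rintro ⟨u, hu, e⟩
      rwa [e]

end Task

/-! ### Rigidity -/

namespace Hereditary

variable {k₁ : K} {rk : K → Ordinal.{u}} {A : Set (RealPath k₀)}

open Cardinal in
-- At most `𝔠` paths have labels of rank at most `rk k`, and each image has only countably many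
-- labels.
theorem exists_rank_apply_le (hrk : ∀ k, #{k' | rk k' ≤ rk k} ≤ 𝔠)
    (hB : ∀ C : Set K, #C ≤ 𝔠 → ∃ k, ∀ c ∈ C, rk c ≤ rk k)
    (f : Hereditary A → Hereditary A) (k : K) :
    ∃ k', rk k ≤ rk k' ∧ ∀ x : Hereditary A, (∀ s, rk (x.1.label s) ≤ rk k) →
      ∀ s, rk ((f x).1.label s) ≤ rk k' := by
  let V := {x : Hereditary A // ∀ s, rk (x.1.label s) ≤ rk k}
  have hV : #V ≤ 𝔠 := by
    refine le_trans ?_ (mk_labels_mem_le (k₀ := k₀) (hrk k))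
    exact mk_le_of_injective (f := fun x => ⟨x.1.1, x.2⟩) fun x y e => by
      have h := Subtype.ext_iff.1 e
      exact Subtype.ext (Subtype.ext h)
  let C : Set K := {k} ∪ Set.range fun p : V × ULift.{u} ℚ => (f p.1.1).1.label p.2.down
  have hC : #C ≤ 𝔠 := by
    refine (mk_union_le _ _).trans (add_le_of_le aleph0_le_continuum ?_ (mk_range_le.trans ?_))
    · simpa using one_lt_aleph0.le.trans aleph0_le_continuum
    · rw [mk_prod, lift_id, lift_id]
      exact mul_le_of_le aleph0_le_continuum hV (by simpa using aleph0_le_continuum)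
  obtain ⟨k', hk'⟩ := hB C hC
  refine ⟨k', hk' _ (Or.inl rfl), fun x hx s => ?_⟩
  obtain ⟨q, hq⟩ := exists_rat_label_eq (f x).1 s
  rw [← hq]
  exact hk' _ (Or.inr ⟨(⟨x, hx⟩, ⟨q⟩), rfl⟩)

theorem stage_mem (hA : ∀ x : RealPath k₀, x.LeftConst → x ∈ A) (x : Hereditary A) (σ : ℕ → K)
    (n : ℕ) : ∀ y ≤ x.1.stage σ n, y ∈ A := fun y hy =>
  (le_or_leftConst_of_lt_zigzag (hy.trans_lt (stage_lt_zigzag x.1 σ n))).elim (x.2 y) (hA y)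

/-- An upper bound outside the subtree can be replaced by its meet with `f e`, which lies in the
subtree. -/
theorem isLUB_apply (f : Hereditary A ≃o Hereditary A) {y : ℕ → Hereditary A}
    {e : Hereditary A} (h : IsLUB (Set.range y) e) :
    IsLUB (Set.range fun n => (f (y n)).1) (f e).1 := by
  constructor
  · rintro _ ⟨n, rfl⟩
    exact f.monotone (h.1 ⟨n, rfl⟩)
  · intro u hu
    obtain ⟨m, ⟨hm, hmu⟩, hmax⟩ := RealPath.exists_meet (f e).1 u
    refine le_trans ?_ hmu
    change f e ≤ (f e).ofLE m hm
    rw [← f.le_symm_apply]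
    refine h.2 ?_
    rintro _ ⟨n, rfl⟩
    rw [f.le_symm_apply]
    exact hmax ⟨f.monotone (h.1 ⟨n, rfl⟩), hu ⟨n, rfl⟩⟩

/-- A path strictly below the supremum lies below some `y n`. -/
theorem forall_le_mem_of_isLUB {y : ℕ → Hereditary A} {u : RealPath k₀}
    (h : IsLUB (Set.range fun n => (y n).1) u) (hu : u ∈ A) : ∀ x ≤ u, x ∈ A := by
  intro x hx
  by_cases hxy : ∃ n, x ≤ (y n).1
  · obtain ⟨n, hn⟩ := hxy
    exact (y n).2 x hn
  · push Not at hxy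
    have : u ≤ x := h.2 (by
      rintro _ ⟨n, rfl⟩
      exact (RealPath.total_of_le hx (h.1 ⟨n, rfl⟩)).resolve_left (hxy n))
    rwa [le_antisymm hx this]

open Cardinal in
theorem rigid (hA : ∀ x : RealPath k₀, x.LeftConst → x ∈ A) (hk : k₀ ≠ k₁)
    (hrk : ∀ k, #{k' | rk k' ≤ rk k} ≤ 𝔠)
    (hB : ∀ C : Set K, #C ≤ 𝔠 → ∃ k, ∀ c ∈ C, rk c ≤ rk k)
    (hsep : ∀ τ : Task k₀ k₁ rk, ∃ a, (τ.test a ∈ A ↔ ¬ ∃ u ∈ A, τ.target a = some u)) :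
    Rigid (Hereditary A) := by
  intro f
  by_contra hf
  have : Nontrivial K := ⟨k₀, k₁, hk⟩
  obtain ⟨z, hz, hz'⟩ := exists_incomparable hA f hf
  choose F hF hF' using exists_rank_apply_le hrk hB f
  obtain ⟨k, hk1, hkz⟩ : ∃ k, rk k₁ ≤ rk k ∧ ∀ s, rk (z.1.label s) ≤ rk k := by
    obtain ⟨k, hk⟩ := hB ({k₁} ∪ Set.range fun q : ULift.{u} ℚ => z.1.label q.down) (by
      refine (mk_union_le _ _).trans (add_le_of_le aleph0_le_continuum ?_ (mk_range_le.trans ?_))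
      · simpa using one_lt_aleph0.le.trans aleph0_le_continuum
      · simpa using aleph0_le_continuum)
    refine ⟨k, hk _ (Or.inl rfl), fun s => ?_⟩
    obtain ⟨q, hq⟩ := exists_rat_label_eq z.1 s
    exact hk _ (Or.inr ⟨⟨q⟩, hq⟩)
  -- Iterating `F` ensures that `f` maps the stages at level `n` to paths with labels of rank at
  -- most that of tag `n + 1`, so all images stay below the rank of the task.
  let tag : ℕ → K := fun n => F^[n] k
  have htag : ∀ n, tag (n + 1) = F (tag n) := fun n => Function.iterate_succ_apply' F n k
  have hmono : Monotone fun n => rk (tag n) := monotone_nat_of_le_succ fun n => by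
    rw [htag]
    exact hF _
  have h0 : ∀ n, rk k ≤ rk (tag n) := fun n => hmono (Nat.zero_le n)
  have hrank : ∀ {o : Ordinal.{u}} n, o ≤ rk (tag n) → o < seqRank rk tag := fun n h =>
    Ordinal.lt_iSup_add_one_iff.2 ⟨n, h⟩
  let y : (Σ n, Fin n → Bool) → Hereditary A := fun p =>
    ⟨z.1.stage (pattern k₀ k₁ tag (padFalse p)) p.1, stage_mem hA z _ _⟩
  have hzy : ∀ p, f z ≤ f (y p) := fun p => f.monotone (le_stage z.1 _ _)
  have hy : ∀ p s, rk ((y p).1.label s) ≤ rk (tag p.1) := fun p s => by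
    rcases stage_pattern_label (k₁ := k₁) (k := tag) z.1 (padFalse p) p.1 s with
      ⟨s', h⟩ | h | ⟨i, hi, h⟩
    · exact (congrArg rk h).trans_le ((hkz s').trans (h0 _))
    · exact (congrArg rk h).trans_le (hk1.trans (h0 _))
    · exact (congrArg rk h).trans_le (hmono hi)
  let τ : Task k₀ k₁ rk :=
    { base := z.1
      tag := tag
      image := fun p => (f (y p)).1
      monotone_tag := hmono
      rank_one_lt := hrank 0 hk1
      rank_base_lt := fun s => hrank 0 (hkz s)
      rank_image_lt := fun p s => hrank (p.1 + 1) (by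
        rw [htag]
        exact hF' _ _ (hy p) s)
      not_base_le := fun p h => (total_of_le (z := f (y p)) h (hzy p)).elim hz hz'
      not_image_le := fun p h => hz' ((hzy p).trans h) }
  obtain ⟨a, ha⟩ := hsep τ
  have hya : ∀ n, (y (initial a n)).1 = z.1.stage (pattern k₀ k₁ tag a) n := fun n =>
    stage_congr z.1 fun m hm => pattern_congr (padFalse_initial a n) hm
  have hya' : ∀ n, (y (initial a n)).1 < τ.test a := fun n => by
    rw [hya]
    exact stage_lt_zigzag _ _ _
  have hle : ∀ e : Hereditary A, (∀ n, y (initial a n) ≤ e) → τ.test a ≤ e.1 := fun e he =>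
    zigzag_le_of_stage_le fun n => by
      rw [← hya]
      exact he n
  have hmem : τ.test a ∈ A ↔ ∀ x ≤ τ.test a, x ∈ A := by
    refine ⟨fun h x hx => ?_, fun h => h _ le_rfl⟩
    rcases hx.eq_or_lt with rfl | hx
    · exact h
    · exact (le_or_leftConst_of_lt_zigzag hx).elim (z.2 x) (hA x)
  -- If the test path is in `A`, its image under `f` is the target. If not, a target in `A` would
  -- pull back under `f.symm` to an element above the test path. Both contradict `ha`.
  by_cases he : τ.test a ∈ A
  · let e : Hereditary A := ⟨τ.test a, hmem.1 he⟩
    have hlub : IsLUB (Set.range fun n => y (initial a n)) e :=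
      ⟨by rintro _ ⟨n, rfl⟩; exact (hya' n).le, fun u hu => hle u fun n => hu ⟨n, rfl⟩⟩
    exact ha.1 he ⟨_, (f e).2 _ le_rfl, Task.target_eq_some_iff.2 (isLUB_apply f hlub)⟩
  · refine he (ha.2 ?_)
    rintro ⟨u, hu, hlub⟩
    rw [Task.target_eq_some_iff] at hlub
    let u' : Hereditary A :=
      ⟨u, forall_le_mem_of_isLUB (y := fun n => f (y (initial a n))) hlub hu⟩
    refine he ((f.symm u').2 _ (hle _ fun n => ?_))
    rw [f.le_symm_apply]
    exact hlub.1 ⟨n, rfl⟩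

end Hereditary
end RealPath
end BranchwiseReal

open BranchwiseReal RealPath in
theorem mainTheorem2 (κ : Cardinal.{u}) (hκ₂ : 2 ≤ κ)
    (hκ : κ ≤ Order.succ Cardinal.continuum.{u}) :
    ∃ (X : Type u) (_ : PartialOrder X) (_ : BranchwiseReal.IsBranchwiseRealTree X),
      BranchwiseReal.UniformlyBranching X κ ∧
        BranchwiseReal.Rigid X ∧
        BranchwiseReal.ContinuouslyGradable X := by
  induction κ using Cardinal.inductionOn with
  | _ K =>
  obtain ⟨k₀, k₁, hk⟩ := Cardinal.two_le_iff.1 hκ₂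
  have : Nonempty K := ⟨k₀⟩
  obtain ⟨rk, hrk, hB⟩ := exists_rank hκ
  obtain ⟨A, hA, hsep⟩ := Task.exists_separating_set hk hrk
  exact ⟨Hereditary A, inferInstance, Hereditary.isBranchwiseRealTree hA,
    @Hereditary.degree_eq _ _ _ hA (Hereditary.isTreeOrder hA),
    Hereditary.rigid hA hk hrk hB hsep, _, Hereditary.isContinuousGrading_time⟩
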